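/- Let $n$ be a nonnegative integer and work with complex matrices. Write $e_i$ for the standard basis vectors, $\circ$ for the entrywise product, and $C^{(-)}$ for the entrywise inverse of a matrix $C$ without zero entries, with $C^{(-)T}=(C^{(-)})^T$. For an $m\times m$ matrix $C$ let $X_C$ and $\Delta_C$ be the operators $X_C(M)=CM$ and $\Delta_C(M)=C\circ M$ on the space of $m\times m$ matrices. A pair $(A,B)$ of $n\times n$ matrices is a *one-sided Jones pair* if $X_A$ and $\Delta_B$ are invertible and $X_A\Delta_BX_A=\Delta_BX_A\Delta_B$; it is a *Jones pair* if both $(A,B)$ and $(A,B^T)$ are one-sided Jones pairs; a Jones pair is *invertible* if moreover $A$ has no zero entry and $B$ is an invertible matrix. For $m\times m$ matrices $A,B$ with $A$ invertible and $B$ without zero entries, $\mathcal N_{A,B}$ is the algebra of all matrices $M$ for which every vector $Ae_i\circ Be_j$ is an eigenvector; $\Theta_{A,B}(M)$ is the matrix whose $(i,j)$ entry is the eigenvalue of $M\in\mathcal N_{A,B}$ on $Ae_i\circ Be_j$; and $\mathcal N'_{A,B}=\Theta_{A,B}(\mathcal N_{A,B})$ is the dual space. Put $\mathcal N_A=\mathcal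 N_{A,A^{(-)}}$ (the Nomura algebra of $A$) and $\Theta_A=\Theta_{A,A^{(-)}}$. **Theorem.** Let $(A,B)$ be an invertible Jones pair of $n\times n$ matrices with $A$ symmetric, let $d$ be a complex number with $d^2=n$, and let $$V=\begin{pmatrix} dA&-dA&B^{(-)}&B^{(-)}\\ -dA&dA&B^{(-)}&B^{(-)}\\ B^{(-)T}&B^{(-)T}&dA&-dA\\ B^{(-)T}&B^{(-)T}&-dA&dA\end{pmatrix}.$$ Then $\mathcal N_V$ is equal to the set of all $4n\times4n$ matrices of the form $$\begin{pmatrix} F+R&F-R&G+H&G-H\\ F-R&F+R&G-H&G+H\\ B^{-1}GB^T+H_1&B^{-1}GB^T-H_1&B^{-1}FB+R_1&B^{-1}FB-R_1\\ B^{-1}GB^T-H_1&B^{-1}GB^T+H_1&B^{-1}FB-R_1&B^{-1}FB+R_1\end{pmatrix}$$ where $F,R,G,H,R_1,H_1$ are $n\times n$ matrices such that 1. $F\in\mathcal N_A$, $R\in\mathcal N_{A,B}$ and $G\in\mathcal N'_{A,B}$; 2. $A\circ R_1\in\mathcal N_{B^T}$, $A\circ R\in\mathcal N_A$ and $\Theta_{B^T}(A\circ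 R_1)^T=\Theta_A(A\circ R)$; 3. there exist $n\times n$ matrices $S$ and $S_1$ with $$X_{A^{-1}}\Delta_{B^{(-)}}X_H\Delta_{A^{(-)}}X_{B^{-1}}=\Delta_S=X_B\Delta_AX_{H_1}\Delta_BX_A,$$ $$X_{B^T}\Delta_AX_H\Delta_{B^T}X_A=\Delta_{S_1}=X_{A^{-1}}\Delta_{B^{(-)T}}X_{H_1}\Delta_{A^{(-)}}X_{(B^{-1})^T}.$$ -/

import Mathlib

open scoped Matrix

namespace JonesPair

section

variable {ι : Type*} [Fintype ι] [DecidableEq ι]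

/-- The operator `X_C : M ↦ C M` on square matrices. -/
def X (C : Matrix ι ι ℂ) : Module.End ℂ (Matrix ι ι ℂ) :=
  LinearMap.mulLeft ℂ C

/-- The operator `Δ_C : M ↦ C ∘ M` (entrywise product) on square matrices. -/
def Δ (C : Matrix ι ι ℂ) : Module.End ℂ (Matrix ι ι ℂ) where
  toFun M := C ⊙ M
  map_add' M N := Matrix.hadamard_add C M N
  map_smul' c M := Matrix.hadamard_smul C M c

/-- The Schur (entrywise) inverse `C^{(-)}`. -/
noncomputable def schurInv (C : Matrix ι ι ℂ) : Matrix ι ι ℂ :=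
  C.map (fun z => z⁻¹)

/-- All entries are nonzero, so that the Schur inverse really is an inverse. -/
def SchurInvertible (C : Matrix ι ι ℂ) : Prop :=
  ∀ i j, C i j ≠ 0

/-- `(A, B)` is a one-sided Jones pair: `X_A` and `Δ_B` are invertible and satisfy the
braid relation. -/
structure IsOneSidedJonesPair (A B : Matrix ι ι ℂ) : Prop where
  isUnit_X : IsUnit (X A)
  isUnit_Δ : IsUnit (Δ B)
  braid : X A * Δ B * X A = Δ B * X A * Δ B

/-- `(A, B)` is a Jones pair: both `(A, B)` and `(A, Bᵀ)` are one-sided Jones pairs. -/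
def IsJonesPair (A B : Matrix ι ι ℂ) : Prop :=
  IsOneSidedJonesPair A B ∧ IsOneSidedJonesPair A Bᵀ

/-- A Jones pair `(A, B)` is invertible if moreover `A` is Schur invertible and `B` is
invertible. -/
structure IsInvertibleJonesPair (A B : Matrix ι ι ℂ) : Prop where
  isJonesPair : IsJonesPair A B
  schurInvertible : SchurInvertible A
  isUnit : IsUnit B

/-- `N_{A,B}`: the algebra of matrices having every vector `A e_i ∘ B e_j` as an
eigenvector. -/
def nomuraPair (A B : Matrix ι ι ℂ) : Subalgebra ℂ (Matrix ι ι ℂ) where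
  carrier := {M | ∀ i j, ∃ c : ℂ, M *ᵥ (A.col i * B.col j) = c • (A.col i * B.col j)}
  mul_mem' := by
    intro M N hM hN i j
    obtain ⟨a, ha⟩ := hM i j
    obtain ⟨b, hb⟩ := hN i j
    exact ⟨b * a, by rw [← Matrix.mulVec_mulVec, hb, Matrix.mulVec_smul, ha, smul_smul]⟩
  add_mem' := by
    intro M N hM hN i j
    obtain ⟨a, ha⟩ := hM i j
    obtain ⟨b, hb⟩ := hN i j
    exact ⟨a + b, by rw [Matrix.add_mulVec, ha, hb, add_smul]⟩
  algebraMap_mem' := by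
    intro r i j
    exact ⟨r, by rw [Algebra.algebraMap_eq_smul_one, Matrix.smul_mulVec, Matrix.one_mulVec]⟩

/-- `Θ_{A,B} : N_{A,B} → M_n(ℂ)`: the `(i, j)` entry of `Θ_{A,B}(M)` is the eigenvalue of `M`
on `A e_i ∘ B e_j`. (It is unique whenever these vectors are nonzero, in particular when `A`
is invertible and `B` is Schur invertible.) -/
noncomputable def thetaPair (A B : Matrix ι ι ℂ) (M : nomuraPair A B) : Matrix ι ι ℂ :=
  Matrix.of fun i j => (M.2 i j).choose

/-- The dual space `N'_{A,B}`: the image of `N_{A,B}` under `Θ_{A,B}`. -/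
def dualNomuraPair (A B : Matrix ι ι ℂ) : Set (Matrix ι ι ℂ) :=
  Set.range (thetaPair A B)

/-- The Nomura algebra `N_A = N_{A, A^{(-)}}`. -/
noncomputable def nomura (A : Matrix ι ι ℂ) : Subalgebra ℂ (Matrix ι ι ℂ) :=
  nomuraPair A (schurInv A)

/-- `Θ_A = Θ_{A, A^{(-)}}`. -/
noncomputable def theta (A : Matrix ι ι ℂ) (M : nomura A) : Matrix ι ι ℂ :=
  thetaPair A (schurInv A) M

/-- The `4n × 4n` matrix with the sixteen given `n × n` blocks, listed row by row. -/
def blocks4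
    (a₁ a₂ a₃ a₄ b₁ b₂ b₃ b₄ c₁ c₂ c₃ c₄ d₁ d₂ d₃ d₄ : Matrix ι ι ℂ) :
    Matrix ((ι ⊕ ι) ⊕ (ι ⊕ ι)) ((ι ⊕ ι) ⊕ (ι ⊕ ι)) ℂ :=
  Matrix.fromBlocks
    (Matrix.fromBlocks a₁ a₂ b₁ b₂) (Matrix.fromBlocks a₃ a₄ b₃ b₄)
    (Matrix.fromBlocks c₁ c₂ d₁ d₂) (Matrix.fromBlocks c₃ c₄ d₃ d₄)

/-- The `4n × 4n` matrix `V` built from `(A, B)` and the loop variable `d`. -/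
noncomputable def V (A B : Matrix ι ι ℂ) (d : ℂ) :
    Matrix ((ι ⊕ ι) ⊕ (ι ⊕ ι)) ((ι ⊕ ι) ⊕ (ι ⊕ ι)) ℂ :=
  blocks4
    (d • A)         (-(d • A))      (schurInv B) (schurInv B)
    (-(d • A))      (d • A)         (schurInv B) (schurInv B)
    (schurInv B)ᵀ   (schurInv B)ᵀ   (d • A)      (-(d • A))
    (schurInv B)ᵀ   (schurInv B)ᵀ   (-(d • A))   (d • A)

end

end JonesPair

/-!
The braid relations say that the products `A e_i ∘ B e_j` and `A e_i ∘ Bᵀ e_j` are eigenvectors of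
`A`, with eigenvalue matrices `B` and `Bᵀ`, and they force `A` and `B` to be type II matrices.
Duality for type II matrices exchanges a matrix with its matrix of eigenvalues, and shows that `B`
and `Bᵀ` carry, up to scalars, the column quotients of `A` and those of `B^{(-)}` and `B^{(-)T}` to
one another.

The matrix `V` is type II, so `N_V` is commutative. It contains the permutation matrix swapping the
two halves of each half, so all its elements consist of `2 × 2` block circulant matrices. Such an
element has a symmetric part `[F, G; G₁, F₁]`, tested by the quotients of two columns in the same
half of `V`, and an antisymmetric part `[R, H; H₁, R₁]`, tested by the quotients of columns in
different halves. The signs in `V` force the diagonal and off-diagonal blocks to act separately.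
The relations above reduce the conditions on the symmetric part to `F ∈ N_A`, `G ∈ N'_{A,B}`,
`F₁ = B⁻¹ F B` and `G₁ = B⁻¹ G Bᵀ`, while those on the antisymmetric part are the remaining
conditions of the theorem.
-/

namespace JonesPair

section Transfers

variable {R : Type*} [CommSemiring R] {ι ι' κ κ' μ : Type*}

/-- The family of entrywise products `P e_i ∘ Q e_j` of the columns of two matrices. -/
def colProd (P : Matrix κ ι R) (Q : Matrix κ ι' R) (i : ι) (j : ι') : κ → R :=
  P.col i * Q.col j

/-- The matrix `M` maps each vector `u i j` to the multiple `T i j • v i j`. For `u = v` the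
vectors are eigenvectors of `M`, and `T` is the matrix of eigenvalues. -/
def Transfers [Fintype κ] (M : Matrix κ' κ R) (u : ι → ι' → κ → R) (v : ι → ι' → κ' → R)
    (T : Matrix ι ι' R) : Prop :=
  ∀ i j, M *ᵥ u i j = T i j • v i j

variable [Fintype κ] {M : Matrix κ' κ R} {u : ι → ι' → κ → R} {v : ι → ι' → κ' → R}
  {T : Matrix ι ι' R}

theorem Transfers.smul (h : Transfers M u v T) (c : R) : Transfers (c • M) u v (c • T) :=
  fun i j ↦ by rw [Matrix.smul_mulVec, h i j, Matrix.smul_apply, smul_assoc]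

theorem Transfers.comp [Fintype κ'] {N : Matrix μ κ' R} {w : ι → ι' → μ → R} {S : Matrix ι ι' R}
    (hN : Transfers N v w S) (hM : Transfers M u v T) : Transfers (N * M) u w (T ⊙ S) :=
  fun i j ↦ by
    rw [← Matrix.mulVec_mulVec, hM i j, Matrix.mulVec_smul, hN i j, smul_smul,
      Matrix.hadamard_apply]

theorem transfers_colProd_swap {P : Matrix κ ι R} {Q : Matrix κ ι' R} {P' : Matrix κ' ι R}
    {Q' : Matrix κ' ι' R} :
    Transfers M (colProd Q P) (colProd Q' P') Tᵀ ↔ Transfers M (colProd P Q) (colProd P' Q') T := by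
  simp only [Transfers, colProd, mul_comm (Q.col _), mul_comm (Q'.col _), Matrix.transpose_apply]
  exact forall_comm

end Transfers

section Transfers

variable {𝕜 ι ι' κ κ' : Type*} [Field 𝕜] [Fintype κ] {M : Matrix κ' κ 𝕜} {u : ι → ι' → κ → 𝕜}
  {v : ι → ι' → κ' → 𝕜} {T : Matrix ι ι' 𝕜} {c : 𝕜}

theorem smul_transfers_smul_iff (hc : c ≠ 0) :
    Transfers (c • M) u v (c • T) ↔ Transfers M u v T :=
  ⟨fun h ↦ by simpa only [inv_smul_smul₀ hc] using h.smul c⁻¹, fun h ↦ h.smul c⟩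

theorem transfers_smul_smul_iff (hc : c ≠ 0) :
    Transfers M (c • u) (c • v) T ↔ Transfers M u v T :=
  forall₂_congr fun i j ↦ by
    simp only [Pi.smul_apply, Matrix.mulVec_smul, smul_comm (T i j) c]
    exact (smul_right_injective _ hc).eq_iff

end Transfers

section SchurInv

variable {ι : Type*} {C : Matrix ι ι ℂ}

theorem schurInv_schurInv (C : Matrix ι ι ℂ) : schurInv (schurInv C) = C :=
  Matrix.ext fun _ _ ↦ inv_inv _

theorem hadamard_schurInv (hC : SchurInvertible C) : C ⊙ schurInv C = Matrix.of 1 :=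
  Matrix.ext fun i j ↦ mul_inv_cancel₀ (hC i j)

theorem SchurInvertible.schurInv (hC : SchurInvertible C) : SchurInvertible (schurInv C) :=
  fun i j ↦ inv_ne_zero (hC i j)

theorem SchurInvertible.transpose (hC : SchurInvertible C) : SchurInvertible Cᵀ :=
  fun i j ↦ hC j i

theorem SchurInvertible.smul {c : ℂ} (hC : SchurInvertible C) (hc : c ≠ 0) :
    SchurInvertible (c • C) :=
  fun i j ↦ mul_ne_zero hc (hC i j)

/-- The family of entrywise quotients `W e_i ∘ W^{(-)} e_j` of the columns of a matrix. -/
noncomputable def colQuot (W : Matrix ι ι ℂ) : ι → ι → ι → ℂ :=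
  colProd W (JonesPair.schurInv W)

end SchurInv

section Square

variable {ι : Type*} [Fintype ι] {M P Q S T : Matrix ι ι ℂ} {u u' v v' w : ι → ι → ι → ℂ}

theorem transfers_colQuot_schurInv_iff :
    Transfers M (colQuot (schurInv P)) (colQuot (schurInv Q)) Tᵀ ↔
      Transfers M (colQuot P) (colQuot Q) T := by
  simp only [colQuot, schurInv_schurInv, transfers_colProd_swap]

theorem sum_colQuot_transpose (W : Matrix ι ι ℂ) (k m : ι) :
    ∑ l, colQuot Wᵀ k m l = (W * (schurInv W)ᵀ) k m :=
  rfl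

theorem Transfers.coeff_unique (hS : Transfers M u (colProd P Q) S)
    (hT : Transfers M u (colProd P Q) T) (hP : SchurInvertible P) (hQ : SchurInvertible Q) :
    S = T := by
  ext i j
  have h := congrFun ((hS i j).symm.trans (hT i j)) i
  exact mul_right_cancel₀ (mul_ne_zero (hP i i) (hQ i j)) h

variable [DecidableEq ι]

theorem eq_of_forall_mulVec_colProd_eq {N : Matrix ι ι ℂ} (hP : IsUnit P) (hQ : SchurInvertible Q)
    (h : ∀ i j, M *ᵥ colProd P Q i j = N *ᵥ colProd P Q i j) : M = N := by
  ext k l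
  have vecMul_apply (D : Matrix ι ι ℂ) (i : ι) :
      ((D k * Qᵀ l) ᵥ* P) i = (D *ᵥ colProd P Q i l) k :=
    Finset.sum_congr rfl fun m _ ↦ by
      simp only [colProd, Pi.mul_apply, Matrix.transpose_apply, Matrix.col_apply]
      ring
  have hrow : M k * Qᵀ l = N k * Qᵀ l :=
    Matrix.vecMul_injective_of_isUnit hP (funext fun i ↦ by simp only [vecMul_apply, h])
  exact mul_right_cancel₀ (hQ l l) (congrFun hrow l)

theorem Transfers.unique {N : Matrix ι ι ℂ} (hM : Transfers M (colProd P Q) v T)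
    (hN : Transfers N (colProd P Q) v T) (hP : IsUnit P) (hQ : SchurInvertible Q) : M = N :=
  eq_of_forall_mulVec_colProd_eq hP hQ fun i j ↦ (hM i j).trans (hN i j).symm

theorem Transfers.inv (h : Transfers M u v T) (hM : IsUnit M) (hT : SchurInvertible T) :
    Transfers M⁻¹ v u (schurInv T) := fun i j ↦ by
  have hdet := (Matrix.isUnit_iff_isUnit_det M).mp hM
  rw [← inv_smul_smul₀ (hT i j) (v i j), ← h i j, Matrix.mulVec_smul, Matrix.mulVec_mulVec,
    Matrix.nonsing_inv_mul M hdet, Matrix.one_mulVec]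
  rfl

section Intertwiner

variable {K L c : Matrix ι ι ℂ}

theorem transfers_mul_right_iff (hK : Transfers K u v c) (hKu : IsUnit K)
    (hc : SchurInvertible c) : Transfers (M * K) u w (c ⊙ T) ↔ Transfers M v w T := by
  refine ⟨fun h ↦ ?_, fun h ↦ h.comp hK⟩
  have hinv := h.comp (hK.inv hKu hc)
  rwa [Matrix.mul_assoc, Matrix.mul_nonsing_inv K ((Matrix.isUnit_iff_isUnit_det K).mp hKu),
    Matrix.mul_one, ← Matrix.hadamard_assoc, Matrix.hadamard_comm _ c, hadamard_schurInv hc,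
    Matrix.of_one_hadamard] at hinv

theorem Transfers.conj (hM : Transfers M u' v' T) (hK : Transfers K u u' c)
    (hL : Transfers L v v' c) (hLu : IsUnit L) (hc : SchurInvertible c) :
    Transfers (L⁻¹ * M * K) u v T := by
  have h := (hL.inv hLu hc).comp (hM.comp hK)
  rwa [Matrix.hadamard_comm c T, Matrix.hadamard_assoc, hadamard_schurInv hc,
    Matrix.hadamard_of_one, ← Matrix.mul_assoc] at h

end Intertwiner

end Square

section Nomura

variable {ι : Type*} [Fintype ι] [DecidableEq ι] {M N P Q S W : Matrix ι ι ℂ}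

theorem mem_nomuraPair_iff :
    M ∈ nomuraPair P Q ↔ ∃ S, Transfers M (colProd P Q) (colProd P Q) S :=
  ⟨fun h ↦ ⟨Matrix.of fun i j ↦ (h i j).choose, fun i j ↦ (h i j).choose_spec⟩,
    fun ⟨S, hS⟩ i j ↦ ⟨S i j, hS i j⟩⟩

theorem mem_nomura_iff : M ∈ nomura W ↔ ∃ S, Transfers M (colQuot W) (colQuot W) S :=
  mem_nomuraPair_iff

theorem transfers_thetaPair (M : nomuraPair P Q) :
    Transfers (M : Matrix ι ι ℂ) (colProd P Q) (colProd P Q) (thetaPair P Q M) :=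
  fun i j ↦ (M.2 i j).choose_spec

theorem thetaPair_eq_iff (hP : SchurInvertible P) (hQ : SchurInvertible Q) (M : nomuraPair P Q) :
    thetaPair P Q M = S ↔ Transfers (M : Matrix ι ι ℂ) (colProd P Q) (colProd P Q) S :=
  ⟨fun h ↦ h ▸ transfers_thetaPair M, fun h ↦ (transfers_thetaPair M).coeff_unique h hP hQ⟩

theorem theta_eq_iff (hW : SchurInvertible W) (M : nomura W) :
    theta W M = S ↔ Transfers (M : Matrix ι ι ℂ) (colQuot W) (colQuot W) S :=
  thetaPair_eq_iff hW hW.schurInv M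

theorem mem_dualNomuraPair_iff (hP : SchurInvertible P) (hQ : SchurInvertible Q) :
    S ∈ dualNomuraPair P Q ↔ ∃ M, Transfers M (colProd P Q) (colProd P Q) S :=
  ⟨fun ⟨M, hM⟩ ↦ ⟨M, hM ▸ transfers_thetaPair M⟩, fun ⟨M, hM⟩ ↦
    ⟨⟨M, mem_nomuraPair_iff.mpr ⟨S, hM⟩⟩, (thetaPair_eq_iff hP hQ _).mpr hM⟩⟩

theorem commute_of_mem_nomuraPair (hP : IsUnit P) (hQ : SchurInvertible Q)
    (hM : M ∈ nomuraPair P Q) (hN : N ∈ nomuraPair P Q) : Commute M N := by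
  obtain ⟨S, hS⟩ := mem_nomuraPair_iff.mp hM
  obtain ⟨T, hT⟩ := mem_nomuraPair_iff.mp hN
  exact (hS.comp hT).unique (Matrix.hadamard_comm S T ▸ hT.comp hS) hP hQ

end Nomura

section TypeII

variable {ι : Type*} [Fintype ι] [DecidableEq ι] {M P Q S T W : Matrix ι ι ℂ}

/-- A type II matrix: it has no zero entry, and its inverse is the transpose of its Schur inverse
up to the factor `n`. -/
structure IsTypeII (W : Matrix ι ι ℂ) : Prop where
  schurInvertible : SchurInvertible W
  mul_schurInv_transpose : W * (schurInv W)ᵀ = (Fintype.card ι : ℂ) • 1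

theorem isTypeII_of_inv_apply_mul_apply {a c : ι → ℂ} (hW : IsUnit W)
    (h : ∀ i k, W⁻¹ i k * W k i = a i * c k) : IsTypeII W := by
  have hdet := (Matrix.isUnit_iff_isUnit_det W).mp hW
  have hrow (i) : a i * ∑ k, c k = 1 := by
    simp only [Finset.mul_sum, ← h, ← Matrix.mul_apply, Matrix.nonsing_inv_mul W hdet,
      Matrix.one_apply_eq]
  have hcol (k) : (∑ i, a i) * c k = 1 := by
    simp only [Finset.sum_mul, ← h, mul_comm (W⁻¹ _ _), ← Matrix.mul_apply,
      Matrix.mul_nonsing_inv W hdet, Matrix.one_apply_eq]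
  have hcard : (∑ i, a i) * ∑ k, c k = Fintype.card ι := by
    simp only [Finset.sum_mul, hrow, Finset.sum_const, Finset.card_univ, nsmul_eq_mul, mul_one]
  have hentry (i k) : (Fintype.card ι * W⁻¹ i k) * W k i = 1 := by
    rw [mul_assoc, h, ← hcard]
    linear_combination (a i * ∑ k, c k) * hcol k + hrow i
  have hinv : (schurInv W)ᵀ = (Fintype.card ι : ℂ) • W⁻¹ :=
    Matrix.ext fun i k ↦ inv_eq_of_mul_eq_one_left (hentry i k)
  exact ⟨fun k i ↦ right_ne_zero_of_mul_eq_one (hentry i k), by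
    rw [hinv, Matrix.mul_smul, Matrix.mul_nonsing_inv W hdet]⟩

theorem transfers_colProd_iff_diagonal :
    Transfers M (colProd P Q) (colProd P Q) T ↔ ∀ i, M * (Matrix.diagonal (P.col i) * Q) =
      Matrix.diagonal (P.col i) * Q * Matrix.diagonal (T i) := by
  refine forall_congr' fun i ↦ ?_
  simp only [← Matrix.ext_iff, funext_iff]
  rw [forall_comm]
  refine forall₂_congr fun k j ↦ ?_
  rw [Matrix.mul_diagonal, Matrix.diagonal_mul, mul_comm _ (T i j), Matrix.mul_apply]
  simp only [Matrix.diagonal_mul]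
  rfl

theorem Transfers.sum_coeff (h : Transfers M (colProd P Q) (colProd P Q) T)
    (hP : SchurInvertible P) (hQ : IsUnit Q) (i : ι) : ∑ j, T i j = M.trace := by
  have hunit : IsUnit (Matrix.diagonal (P.col i) * Q) :=
    (Matrix.isUnit_diagonal.mpr (Pi.isUnit_iff.mpr fun k ↦ (hP k i).isUnit)).mul hQ
  have hdet := (Matrix.isUnit_iff_isUnit_det _).mp hunit
  rw [← Matrix.trace_diagonal, ← Matrix.nonsing_inv_mul_cancel_left _ (Matrix.diagonal (T i)) hdet,
    ← transfers_colProd_iff_diagonal.mp h, Matrix.trace_mul_comm,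
    Matrix.mul_nonsing_inv_cancel_right _ _ hdet]

namespace IsTypeII

theorem mul_inv_smul_schurInv_transpose [Nonempty ι] (h : IsTypeII W) :
    W * ((Fintype.card ι : ℂ)⁻¹ • (JonesPair.schurInv W)ᵀ) = 1 := by
  rw [Matrix.mul_smul, h.mul_schurInv_transpose,
    inv_smul_smul₀ (Nat.cast_ne_zero.mpr Fintype.card_ne_zero)]

theorem isUnit [Nonempty ι] (h : IsTypeII W) : IsUnit W :=
  IsUnit.of_mul_eq_one _ h.mul_inv_smul_schurInv_transpose

theorem inv_eq [Nonempty ι] (h : IsTypeII W) :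
    W⁻¹ = (Fintype.card ι : ℂ)⁻¹ • (JonesPair.schurInv W)ᵀ :=
  Matrix.inv_eq_right_inv h.mul_inv_smul_schurInv_transpose

theorem schurInv_transpose_mul (h : IsTypeII W) :
    (JonesPair.schurInv W)ᵀ * W = (Fintype.card ι : ℂ) • 1 := by
  rcases isEmpty_or_nonempty ι with _ | _
  · exact Subsingleton.elim _ _
  · have hcard : (Fintype.card ι : ℂ) ≠ 0 := Nat.cast_ne_zero.mpr Fintype.card_ne_zero
    rw [← smul_inv_smul₀ hcard (JonesPair.schurInv W)ᵀ, Matrix.smul_mul,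
      mul_eq_one_comm.mp h.mul_inv_smul_schurInv_transpose]

theorem transpose (h : IsTypeII W) : IsTypeII Wᵀ where
  schurInvertible := h.schurInvertible.transpose
  mul_schurInv_transpose := by
    simpa only [Matrix.transpose_mul, Matrix.transpose_smul, Matrix.transpose_one] using!
      congrArg Matrix.transpose h.schurInv_transpose_mul

protected theorem schurInv (h : IsTypeII W) : IsTypeII (schurInv W) where
  schurInvertible := h.schurInvertible.schurInv
  mul_schurInv_transpose := by
    simpa only [schurInv_schurInv, Matrix.transpose_mul, Matrix.transpose_smul,
      Matrix.transpose_one, Matrix.transpose_transpose] using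
      congrArg Matrix.transpose h.mul_schurInv_transpose

end IsTypeII

theorem transfers_dual_iff_diagonal (hP : SchurInvertible P) :
    Transfers T (colQuot (schurInv Q)ᵀ) (colQuot Pᵀ) ((Fintype.card ι : ℂ) • Mᵀ) ↔
      ∀ i, Matrix.diagonal (P.col i) * Q * Matrix.diagonal (T i) * (schurInv Q)ᵀ =
        (Fintype.card ι : ℂ) • (M * Matrix.diagonal (P.col i)) := by
  have hleft (i k l : ι) :
      (Matrix.diagonal (P.col i) * Q * Matrix.diagonal (T i) * (schurInv Q)ᵀ) k l =
        P k i * (T *ᵥ colQuot (schurInv Q)ᵀ l k) i := by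
    rw [Matrix.mul_apply, Matrix.mulVec, dotProduct, Finset.mul_sum]
    refine Finset.sum_congr rfl fun j _ ↦ ?_
    simp only [Matrix.mul_diagonal, Matrix.diagonal_mul, Matrix.col_apply, Matrix.transpose_apply,
      colQuot, colProd, Pi.mul_apply, schurInv, Matrix.map_apply, inv_inv]
    ring
  have hright (i k l : ι) : ((Fintype.card ι : ℂ) • (M * Matrix.diagonal (P.col i))) k l =
      P k i * ((((Fintype.card ι : ℂ) • Mᵀ) l k) • colQuot Pᵀ l k) i := by
    simp only [Matrix.smul_apply, Matrix.mul_diagonal, Pi.smul_apply, Matrix.col_apply,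
      Matrix.transpose_apply, colQuot, colProd, Pi.mul_apply, schurInv, Matrix.map_apply,
      smul_eq_mul]
    field [hP k i]
  refine ⟨fun h i ↦ ?_, fun h l k ↦ funext fun i ↦ ?_⟩
  · ext k l
    rw [hleft, hright, h l k]
  · exact mul_left_cancel₀ (hP k i) (by rw [← hleft, ← hright, h i])

theorem transfers_iff_dual [Nonempty ι] (hP : SchurInvertible P) (hQ : IsTypeII Q) :
    Transfers M (colProd P Q) (colProd P Q) T ↔
      Transfers T (colQuot (schurInv Q)ᵀ) (colQuot Pᵀ) ((Fintype.card ι : ℂ) • Mᵀ) := by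
  have hcard : (Fintype.card ι : ℂ) ≠ 0 := Nat.cast_ne_zero.mpr Fintype.card_ne_zero
  rw [transfers_colProd_iff_diagonal, transfers_dual_iff_diagonal hP]
  refine forall_congr' fun i ↦ ⟨fun h ↦ ?_, fun h ↦ ?_⟩
  · rw [← h, Matrix.mul_assoc, Matrix.mul_assoc, hQ.mul_schurInv_transpose, Matrix.mul_smul,
      Matrix.mul_smul, Matrix.mul_one]
  · apply smul_right_injective _ hcard
    simp only
    rw [← Matrix.mul_assoc, ← Matrix.smul_mul, ← h, Matrix.mul_assoc, hQ.schurInv_transpose_mul,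
      Matrix.mul_smul, Matrix.mul_one]

theorem transfers_colQuot_iff_dual [Nonempty ι] (hW : IsTypeII W) :
    Transfers M (colQuot W) (colQuot W) T ↔
      Transfers T (colQuot Wᵀ) (colQuot Wᵀ) ((Fintype.card ι : ℂ) • Mᵀ) := by
  simpa only [colQuot, schurInv_schurInv] using
    transfers_iff_dual (T := T) hW.schurInvertible hW.schurInv

end TypeII

section Operators

variable {ι : Type*} {C D M P Q P' Q' S T : Matrix ι ι ℂ}

theorem Δ_mul_Δ_schurInv (hC : SchurInvertible C) : Δ C * Δ (schurInv C) = 1 :=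
  LinearMap.ext fun M ↦ by
    change C ⊙ (schurInv C ⊙ M) = M
    rw [← Matrix.hadamard_assoc, hadamard_schurInv hC, Matrix.of_one_hadamard]

theorem schurInvertible_of_isUnit_Δ (h : IsUnit (Δ C)) : SchurInvertible C := fun i j ↦ by
  classical
  obtain ⟨E, hE⟩ := h.exists_right_inv
  have hij := congrFun (congrFun (LinearMap.congr_fun hE (Matrix.single i j 1)) i) j
  exact left_ne_zero_of_mul_eq_one (hij.trans (Matrix.single_apply_same i j 1))

theorem Δ_vecMulVec_single [DecidableEq ι] (C : Matrix ι ι ℂ) (v : ι → ℂ) (j : ι) :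
    Δ C (Matrix.vecMulVec v (Pi.single j 1)) =
      Matrix.vecMulVec (v * C.col j) (Pi.single j 1) := by
  ext k l
  change C k l * (v k * (Pi.single j 1 : ι → ℂ) l) = v k * C k j * (Pi.single j 1 : ι → ℂ) l
  obtain rfl | hl := eq_or_ne l j
  · ring
  · simp only [Pi.single_eq_of_ne hl, mul_zero]

variable [Fintype ι] [DecidableEq ι]

theorem X_vecMulVec (C : Matrix ι ι ℂ) (v w : ι → ℂ) :
    X C (Matrix.vecMulVec v w) = Matrix.vecMulVec (C *ᵥ v) w :=
  Matrix.mul_vecMulVec C v w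

theorem X_mul_X (C D : Matrix ι ι ℂ) : X C * X D = X (C * D) :=
  (LinearMap.mulLeft_mul ℂ _ C D).symm

theorem isUnit_of_isUnit_X (h : IsUnit (X C)) : IsUnit C := by
  obtain ⟨E, hE⟩ := h.exists_right_inv
  exact IsUnit.of_mul_eq_one (E 1) (LinearMap.congr_fun hE 1)

/-- Both operators are determined by their values on the matrix units. -/
theorem transfers_iff_operator :
    Transfers M (colProd P Q) (colProd P' Q') T ↔
      X M * Δ Q * X P = Δ Q' * X P' * Δ T := by
  have hleft (i j : ι) : (X M * Δ Q * X P) (Matrix.single i j 1) =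
      Matrix.vecMulVec (M *ᵥ colProd P Q i j) (Pi.single j 1) := by
    simp only [Matrix.single_eq_single_vecMulVec_single, Module.End.mul_apply, X_vecMulVec,
      Δ_vecMulVec_single, Matrix.mulVec_single_one, colProd]
  have hright (i j : ι) : (Δ Q' * X P' * Δ T) (Matrix.single i j 1) =
      Matrix.vecMulVec (T i j • colProd P' Q' i j) (Pi.single j 1) := by
    have hsingle : (Pi.single i 1 : ι → ℂ) * T.col j = T i j • Pi.single i 1 := by
      ext k
      obtain rfl | hk := eq_or_ne k i
      · simp
      · simp [hk]
    simp only [Matrix.single_eq_single_vecMulVec_single, Module.End.mul_apply, X_vecMulVec,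
      Δ_vecMulVec_single, hsingle, Matrix.mulVec_smul, Matrix.mulVec_single_one, colProd,
      smul_mul_assoc]
  refine ⟨fun h ↦ Matrix.ext_linearMap ℂ fun i j ↦ LinearMap.ext_ring ?_, fun h i j ↦ ?_⟩
  · change (X M * Δ Q * X P) (Matrix.single i j 1) = (Δ Q' * X P' * Δ T) (Matrix.single i j 1)
    rw [hleft, hright, h i j]
  · have hcol := congrArg (Matrix.col · j) ((hleft i j).symm.trans ((LinearMap.congr_fun h _).trans
      (hright i j)))
    simpa [Matrix.col, Matrix.vecMulVec_apply, funext_iff] using hcol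

theorem operator_eq_Δ_iff_transfers (hC : IsUnit C) (hD : SchurInvertible D) :
    X C * Δ D * X M * Δ Q * X P = Δ S ↔
      Transfers M (colProd P Q) (colProd C⁻¹ (schurInv D)) S := by
  have hinv : X C * Δ D * (Δ (schurInv D) * X C⁻¹) = 1 := by
    rw [mul_assoc, ← mul_assoc (Δ D), Δ_mul_Δ_schurInv hD, one_mul, X_mul_X,
      Matrix.mul_nonsing_inv C ((Matrix.isUnit_iff_isUnit_det C).mp hC)]
    exact LinearMap.mulLeft_one ℂ _
  have hunit : IsUnit (X C * Δ D) := IsUnit.of_mul_eq_one _ hinv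
  rw [transfers_iff_operator, ← hunit.mul_right_inj (b := X M * Δ Q * X P),
    ← mul_assoc (X C * Δ D) _ (Δ S), hinv, one_mul]
  simp only [mul_assoc]

end Operators

section JonesPair

variable {ι : Type*} [Fintype ι] [DecidableEq ι] {A B : Matrix ι ι ℂ}

theorem IsOneSidedJonesPair.transfers (h : IsOneSidedJonesPair A B) :
    Transfers A (colProd A B) (colProd A B) B :=
  transfers_iff_operator.mpr h.braid

theorem isTypeII_left_of_transfers (h : Transfers A (colProd A B) (colProd A B) B)
    (hA : IsUnit A) (hB : IsUnit B) (hB' : SchurInvertible B) : IsTypeII A := by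
  have hinv := h.inv hA hB'
  have hrow (i : ι) : (fun k ↦ A⁻¹ i k * A k i) ᵥ* B = fun _ ↦ A i i := by
    ext j
    have hij := congrFun (hinv i j) i
    simp only [colProd, Pi.smul_apply, Pi.mul_apply, Matrix.col_apply, schurInv, Matrix.map_apply,
      smul_eq_mul, mul_comm (A i i), inv_mul_cancel_left₀ (hB' i j)] at hij
    rw [← hij]
    exact Finset.sum_congr rfl fun k _ ↦ mul_assoc _ _ _
  have hentry (i : ι) : (fun k ↦ A⁻¹ i k * A k i) = A i i • (1 ᵥ* B⁻¹) := by
    apply Matrix.vecMul_injective_of_isUnit hB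
    simp only [Matrix.smul_vecMul, Matrix.vecMul_vecMul, hrow,
      Matrix.nonsing_inv_mul B ((Matrix.isUnit_iff_isUnit_det B).mp hB), Matrix.vecMul_one]
    exact funext fun _ ↦ (mul_one _).symm
  exact isTypeII_of_inv_apply_mul_apply hA fun i ↦ congrFun (hentry i)

/-- Duality turns the hypothesis into `Bᵀ (A^{(-)T} e_k ∘ Aᵀ e_m) = n A_mk (Bᵀ e_k ∘ B^{(-)T} e_m)`.
All row sums of `B` equal `tr A`, so summing the entries gives
`n tr(A) δ_km = n A_mk (B B^{(-)T})_km`. -/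
theorem isTypeII_right_of_transfers (h : Transfers A (colProd A B) (colProd A B) B)
    (hA : IsTypeII A) (hB : IsUnit B) (hB' : SchurInvertible B) : IsTypeII B := by
  rcases isEmpty_or_nonempty ι with _ | _
  · exact ⟨hB', Subsingleton.elim _ _⟩
  have hcard : (Fintype.card ι : ℂ) ≠ 0 := Nat.cast_ne_zero.mpr Fintype.card_ne_zero
  have hdual := (transfers_iff_dual hB' hA).mp (transfers_colProd_swap.mpr h)
  have hsum (v : ι → ℂ) : ∑ i, (Bᵀ *ᵥ v) i = A.trace * ∑ l, v l := by
    simp only [Matrix.mulVec, dotProduct, Matrix.transpose_apply]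
    rw [Finset.sum_comm]
    simp only [← Finset.sum_mul, h.sum_coeff hA.schurInvertible hB, Finset.mul_sum]
  refine ⟨hB', Matrix.ext fun k m ↦ ?_⟩
  obtain rfl | hkm := eq_or_ne k m
  · simp [Matrix.mul_apply, schurInv, hB' k]
  have hkm' : ∑ l, colQuot (schurInv A)ᵀ k m l = 0 := by
    rw [sum_colQuot_transpose, hA.schurInv.mul_schurInv_transpose, Matrix.smul_apply,
      Matrix.one_apply_ne hkm, smul_zero]
  have hzero := hsum (colQuot (schurInv A)ᵀ k m)
  rw [hdual k m, hkm', mul_zero] at hzero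
  simp only [Pi.smul_apply, ← Finset.smul_sum, sum_colQuot_transpose] at hzero
  rw [Matrix.smul_apply, Matrix.one_apply_ne hkm, smul_zero]
  exact (smul_eq_zero.mp hzero).resolve_left (mul_ne_zero hcard (hA.schurInvertible m k))

/-- An invertible Jones pair `(A, B)` with `A` symmetric, in the form in which it is used: `A` and
`B` are type II matrices, and the two braid relations are read as eigenvector conditions. -/
structure IsTypeIIJonesPair (A B : Matrix ι ι ℂ) : Prop where
  isSymm : A.IsSymm
  left : IsTypeII A
  right : IsTypeII B
  transfers : Transfers A (colProd A B) (colProd A B) B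
  transfers_transpose : Transfers A (colProd A Bᵀ) (colProd A Bᵀ) Bᵀ

theorem IsJonesPair.isTypeIIJonesPair (h : IsJonesPair A B) (hB : IsUnit B) (hA : A.IsSymm) :
    IsTypeIIJonesPair A B := by
  have hA' := isUnit_of_isUnit_X h.1.isUnit_X
  have hB' := schurInvertible_of_isUnit_Δ h.1.isUnit_Δ
  have hleft := isTypeII_left_of_transfers h.1.transfers hA' hB hB'
  exact ⟨hA, hleft, isTypeII_right_of_transfers h.1.transfers hleft hB hB', h.1.transfers,
    h.2.transfers⟩

end JonesPair

section Conditions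

variable {ι : Type*} [Fintype ι] [DecidableEq ι] {A B H H₁ R R₁ : Matrix ι ι ℂ}

/-- Condition 2 of the theorem, relating the matrices `R` and `R₁` through `Θ_A` and `Θ_{Bᵀ}`. -/
def ThetaCompatible (A B R R₁ : Matrix ι ι ℂ) : Prop :=
  ∃ (hR₁ : A ⊙ R₁ ∈ nomura Bᵀ) (hR : A ⊙ R ∈ nomura A),
    (theta Bᵀ ⟨A ⊙ R₁, hR₁⟩)ᵀ = theta A ⟨A ⊙ R, hR⟩

/-- Condition 3 of the theorem, relating the matrices `H` and `H₁` through operators `X` and `Δ`. -/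
def OperatorCompatible (A B H H₁ : Matrix ι ι ℂ) : Prop :=
  ∃ S S₁ : Matrix ι ι ℂ,
    X A⁻¹ * Δ (schurInv B) * X H * Δ (schurInv A) * X B⁻¹ = Δ S ∧
    Δ S = X B * Δ A * X H₁ * Δ B * X A ∧
    X Bᵀ * Δ A * X H * Δ Bᵀ * X A = Δ S₁ ∧
    Δ S₁ = X A⁻¹ * Δ (schurInv B)ᵀ * X H₁ * Δ (schurInv A) * X (B⁻¹)ᵀ

theorem thetaCompatible_iff (hA : SchurInvertible A) (hB : SchurInvertible B) :
    ThetaCompatible A B R R₁ ↔ ∃ S, Transfers (A ⊙ R) (colQuot A) (colQuot A) S ∧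
      Transfers (A ⊙ R₁) (colQuot Bᵀ) (colQuot Bᵀ) Sᵀ := by
  constructor
  · rintro ⟨hR₁, hR, heq⟩
    exact ⟨_, (theta_eq_iff hA ⟨A ⊙ R, hR⟩).mp rfl,
      (theta_eq_iff hB.transpose ⟨A ⊙ R₁, hR₁⟩).mp (congrArg Matrix.transpose heq)⟩
  · rintro ⟨S, hR, hR₁⟩
    refine ⟨mem_nomura_iff.mpr ⟨_, hR₁⟩, mem_nomura_iff.mpr ⟨_, hR⟩, ?_⟩
    rw [(theta_eq_iff hA _).mpr hR, (theta_eq_iff hB.transpose _).mpr hR₁,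
      Matrix.transpose_transpose]

theorem operatorCompatible_iff (hA : IsUnit A) (hA' : SchurInvertible A) (hB : IsUnit B)
    (hB' : SchurInvertible B) :
    OperatorCompatible A B H H₁ ↔
      (∃ S, Transfers H (colProd B⁻¹ (schurInv A)) (colProd A B) S ∧
        Transfers H₁ (colProd A B) (colProd B⁻¹ (schurInv A)) S) ∧
      ∃ S, Transfers H (colProd A Bᵀ) (colProd Bᵀ⁻¹ (schurInv A)) S ∧
        Transfers H₁ (colProd Bᵀ⁻¹ (schurInv A)) (colProd A Bᵀ) S := by
  have hAinv : IsUnit A⁻¹ := Matrix.isUnit_nonsing_inv_iff.mpr hA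
  have hBt : IsUnit Bᵀ := (Matrix.isUnit_transpose B).mpr hB
  have hAinvinv : A⁻¹⁻¹ = A :=
    Matrix.nonsing_inv_nonsing_inv A ((Matrix.isUnit_iff_isUnit_det A).mp hA)
  have hBB : schurInv (schurInv B)ᵀ = Bᵀ := schurInv_schurInv Bᵀ
  simp only [OperatorCompatible, eq_comm (a := Δ _), Matrix.transpose_nonsing_inv,
    operator_eq_Δ_iff_transfers hAinv hB'.schurInv,
    operator_eq_Δ_iff_transfers hAinv hB'.schurInv.transpose,
    operator_eq_Δ_iff_transfers hB hA', operator_eq_Δ_iff_transfers hBt hA', hAinvinv,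
    schurInv_schurInv, hBB]
  exact ⟨fun ⟨S, S₁, h₁, h₂, h₃, h₄⟩ ↦ ⟨⟨S, h₁, h₂⟩, S₁, h₃, h₄⟩,
    fun ⟨⟨S, h₁, h₂⟩, S₁, h₃, h₄⟩ ↦ ⟨S, S₁, h₁, h₂, h₃, h₄⟩⟩

end Conditions

namespace IsTypeIIJonesPair

variable {ι : Type*} [Fintype ι] [DecidableEq ι] {A B F G R R₁ H H₁ S T : Matrix ι ι ℂ}

theorem transpose (h : IsTypeIIJonesPair A B) : IsTypeIIJonesPair A Bᵀ where
  isSymm := h.isSymm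
  left := h.left
  right := h.right.transpose
  transfers := h.transfers_transpose
  transfers_transpose := h.transfers

variable [Nonempty ι]

theorem schurInvertible_card_smul (h : IsTypeIIJonesPair A B) :
    SchurInvertible ((Fintype.card ι : ℂ) • A) :=
  h.left.schurInvertible.smul (Nat.cast_ne_zero.mpr Fintype.card_ne_zero)

theorem transfers_right (h : IsTypeIIJonesPair A B) :
    Transfers B (colQuot (schurInv B)ᵀ) (colQuot A) ((Fintype.card ι : ℂ) • A) := by
  simpa only [h.isSymm.eq] using (transfers_iff_dual h.left.schurInvertible h.right).mp h.transfers

theorem transfers_right_transpose (h : IsTypeIIJonesPair A B) :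
    Transfers Bᵀ (colQuot A) (colQuot (schurInv B)ᵀ) ((Fintype.card ι : ℂ) • A) := by
  have hdual := (transfers_iff_dual h.right.schurInvertible h.left).mp
    (transfers_colProd_swap.mpr h.transfers)
  have hA : (schurInv A)ᵀ = schurInv A := congrArg schurInv h.isSymm.eq
  have hB : schurInv (schurInv B)ᵀ = Bᵀ := schurInv_schurInv Bᵀ
  rwa [hA, ← hB, ← Matrix.transpose_smul, transfers_colQuot_schurInv_iff, hB] at hdual

theorem transfers_conj_right (h : IsTypeIIJonesPair A B)
    (hF : Transfers F (colQuot A) (colQuot A) S) :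
    Transfers (B⁻¹ * F * B) (colQuot (schurInv B)ᵀ) (colQuot (schurInv B)ᵀ) S :=
  hF.conj h.transfers_right h.transfers_right h.right.isUnit h.schurInvertible_card_smul

theorem transfers_inv_mul_mul_transpose (h : IsTypeIIJonesPair A B)
    (hG : Transfers G (colQuot (schurInv B)ᵀ) (colQuot A) T) :
    Transfers (B⁻¹ * G * Bᵀ) (colQuot A) (colQuot (schurInv B)ᵀ) T :=
  hG.conj h.transfers_right_transpose h.transfers_right h.right.isUnit h.schurInvertible_card_smul

theorem transfers_inv_mul_mul_transpose_schurInv (h : IsTypeIIJonesPair A B)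
    (hG : Transfers G (colQuot A) (colQuot (schurInv B)) T) :
    Transfers (B⁻¹ * G * Bᵀ) (colQuot (schurInv B)) (colQuot A) T :=
  hG.conj h.transpose.transfers_right h.transpose.transfers_right_transpose h.right.isUnit
    h.schurInvertible_card_smul

theorem transfers_dual (h : IsTypeIIJonesPair A B) :
    Transfers F (colQuot A) (colQuot A) S ↔
      Transfers S (colQuot A) (colQuot A) ((Fintype.card ι : ℂ) • Fᵀ) := by
  simpa only [h.isSymm.eq] using transfers_colQuot_iff_dual h.left

theorem transfers_schurInv_right (h : IsTypeIIJonesPair A B)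
    (hF : Transfers F (colQuot A) (colQuot A) S) :
    Transfers F (colQuot (schurInv B)) (colQuot (schurInv B)) (B⁻¹ * S * B) :=
  (transfers_colQuot_iff_dual h.right.schurInv).mpr
    (h.transfers_conj_right (h.transfers_dual.mp hF))

theorem exists_transfers_schurInv_right (h : IsTypeIIJonesPair A B)
    (hG : Transfers G (colQuot (schurInv B)ᵀ) (colQuot A) T) :
    ∃ S, Transfers G (colQuot A) (colQuot (schurInv B)) S := by
  have hinv := h.transpose.transfers_right.inv h.transpose.right.isUnit h.schurInvertible_card_smul
  have hcomp := (h.transfers_schurInv_right (hG.comp h.transfers_right_transpose)).comp hinv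
  rw [Matrix.mul_nonsing_inv_cancel_right _ _
    ((Matrix.isUnit_iff_isUnit_det _).mp h.transpose.right.isUnit)] at hcomp
  exact ⟨_, hcomp⟩

theorem transfers_colProd_iff (h : IsTypeIIJonesPair A B) :
    Transfers R (colProd A B) (colProd A B) S ↔
      Transfers S (colQuot (schurInv B)ᵀ) (colQuot A) ((Fintype.card ι : ℂ) • Rᵀ) := by
  simpa only [h.isSymm.eq] using transfers_iff_dual h.left.schurInvertible h.right

theorem transfers_colProd_schurInv_iff (h : IsTypeIIJonesPair A B) :
    Transfers R (colProd (schurInv B)ᵀ (schurInv A)) (colProd (schurInv B)ᵀ (schurInv A)) S ↔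
      Transfers S (colQuot A) (colQuot (schurInv B)) ((Fintype.card ι : ℂ) • Rᵀ) := by
  simpa only [schurInv_schurInv, h.isSymm.eq, Matrix.transpose_transpose] using
    transfers_iff_dual h.right.schurInv.schurInvertible.transpose h.left.schurInv

theorem transfers_hadamard (h : IsTypeIIJonesPair A B)
    (hR : Transfers R (colProd A B) (colProd A B) S) :
    Transfers (A ⊙ R) (colQuot A) (colQuot A) ((Fintype.card ι : ℂ)⁻¹ • (S * Bᵀ)) := by
  have hcard : (Fintype.card ι : ℂ) ≠ 0 := Nat.cast_ne_zero.mpr Fintype.card_ne_zero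
  have hS := (h.transfers_colProd_iff.mp hR).comp h.transfers_right_transpose
  rw [← smul_transfers_smul_iff hcard, smul_inv_smul₀ hcard, h.transfers_dual]
  rwa [Matrix.transpose_smul, Matrix.transpose_hadamard, h.isSymm.eq, ← Matrix.smul_hadamard,
    ← Matrix.hadamard_smul]

theorem transfers_hadamard_iff (h : IsTypeIIJonesPair A B) :
    Transfers (A ⊙ R₁) (colQuot Bᵀ) (colQuot Bᵀ) ((Fintype.card ι : ℂ)⁻¹ • (S * Bᵀ))ᵀ ↔
      Transfers R₁ (colProd (schurInv B)ᵀ (schurInv A)) (colProd (schurInv B)ᵀ (schurInv A)) S := by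
  have hcard : (Fintype.card ι : ℂ) ≠ 0 := Nat.cast_ne_zero.mpr Fintype.card_ne_zero
  have hB : schurInv (schurInv B)ᵀ = Bᵀ := schurInv_schurInv Bᵀ
  have hswap (T : Matrix ι ι ℂ) : Transfers (A ⊙ R₁) (colQuot Bᵀ) (colQuot Bᵀ) Tᵀ ↔
      Transfers (A ⊙ R₁) (colQuot (schurInv B)ᵀ) (colQuot (schurInv B)ᵀ) T := by
    simpa only [hB] using
      transfers_colQuot_schurInv_iff (P := (schurInv B)ᵀ) (Q := (schurInv B)ᵀ)
  rw [hswap, ← smul_transfers_smul_iff hcard, smul_inv_smul₀ hcard,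
    transfers_colQuot_iff_dual h.right.schurInv.transpose, Matrix.transpose_transpose,
    h.transfers_colProd_schurInv_iff, ← transfers_mul_right_iff h.transpose.transfers_right
      h.transpose.right.isUnit h.schurInvertible_card_smul, Matrix.transpose_smul,
    Matrix.transpose_hadamard, h.isSymm.eq, Matrix.smul_hadamard, Matrix.hadamard_smul]
  rfl

theorem thetaCompatible_iff_transfers (h : IsTypeIIJonesPair A B)
    (hR : Transfers R (colProd A B) (colProd A B) S) :
    ThetaCompatible A B R R₁ ↔
      Transfers R₁ (colProd (schurInv B)ᵀ (schurInv A)) (colProd (schurInv B)ᵀ (schurInv A)) S := by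
  rw [← h.transfers_hadamard_iff,
    thetaCompatible_iff h.left.schurInvertible h.right.schurInvertible]
  refine ⟨fun ⟨S', hS', hR₁⟩ ↦ ?_, fun hR₁ ↦ ⟨_, h.transfers_hadamard hR, hR₁⟩⟩
  rwa [hS'.coeff_unique (h.transfers_hadamard hR) h.left.schurInvertible
    h.left.schurInvertible.schurInv] at hR₁

theorem nomuraPair_and_thetaCompatible_iff (h : IsTypeIIJonesPair A B) :
    R ∈ nomuraPair A B ∧ ThetaCompatible A B R R₁ ↔
      (∃ S, Transfers R (colProd A B) (colProd A B) S ∧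
        Transfers R₁ (colProd (schurInv B)ᵀ (schurInv A)) (colProd (schurInv B)ᵀ (schurInv A)) S) ∧
      ∃ S, Transfers R (colProd (schurInv B) (schurInv A)) (colProd (schurInv B) (schurInv A)) S ∧
        Transfers R₁ (colProd A Bᵀ) (colProd A Bᵀ) S := by
  constructor
  · rintro ⟨hR, hθ⟩
    obtain ⟨S, hS⟩ := mem_nomuraPair_iff.mp hR
    have hS₁ := (h.thetaCompatible_iff_transfers hS).mp hθ
    exact ⟨⟨S, hS, hS₁⟩, B⁻¹ * S * Bᵀ,
      h.transpose.transfers_colProd_schurInv_iff.mpr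
        (h.transfers_inv_mul_mul_transpose (h.transfers_colProd_iff.mp hS)),
      h.transpose.transfers_colProd_iff.mpr
        (h.transfers_inv_mul_mul_transpose_schurInv (h.transfers_colProd_schurInv_iff.mp hS₁))⟩
  · rintro ⟨⟨S, hS, hS₁⟩, -⟩
    exact ⟨mem_nomuraPair_iff.mpr ⟨S, hS⟩, (h.thetaCompatible_iff_transfers hS).mpr hS₁⟩

theorem operatorCompatible_iff_transfers (h : IsTypeIIJonesPair A B) {d : ℂ} (hd : d ≠ 0)
    (hd' : d ^ 2 = Fintype.card ι) :
    OperatorCompatible A B H H₁ ↔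
      (∃ S, Transfers H (d⁻¹ • colProd (schurInv B)ᵀ (schurInv A)) (d • colProd A B) S ∧
        Transfers H₁ (d • colProd A B) (d⁻¹ • colProd (schurInv B)ᵀ (schurInv A)) S) ∧
      ∃ S, Transfers H (d • colProd A Bᵀ) (d⁻¹ • colProd (schurInv B) (schurInv A)) S ∧
        Transfers H₁ (d⁻¹ • colProd (schurInv B) (schurInv A)) (d • colProd A Bᵀ) S := by
  have colProd_inv {C : Matrix ι ι ℂ} (hC : IsTypeII C) :
      colProd C⁻¹ (schurInv A) = d⁻¹ • d⁻¹ • colProd (schurInv C)ᵀ (schurInv A) := by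
    rw [hC.inv_eq, smul_smul, ← sq, inv_pow, hd']
    exact funext₂ fun i j ↦ smul_mul_assoc (Fintype.card ι : ℂ)⁻¹ ((schurInv C)ᵀ.col i) _
  have rescale_left {M T : Matrix ι ι ℂ} {u v : ι → ι → ι → ℂ} :
      Transfers M (d⁻¹ • d⁻¹ • u) v T ↔ Transfers M (d⁻¹ • u) (d • v) T := by
    rw [← transfers_smul_smul_iff hd, smul_inv_smul₀ hd]
  have rescale_right {M T : Matrix ι ι ℂ} {u v : ι → ι → ι → ℂ} :
      Transfers M u (d⁻¹ • d⁻¹ • v) T ↔ Transfers M (d • u) (d⁻¹ • v) T := by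
    rw [← transfers_smul_smul_iff hd, smul_inv_smul₀ hd]
  have hB : (schurInv Bᵀ)ᵀ = schurInv B := rfl
  simp only [operatorCompatible_iff h.left.isUnit h.left.schurInvertible h.right.isUnit
    h.right.schurInvertible, colProd_inv h.right, colProd_inv h.right.transpose, hB, rescale_left,
    rescale_right]

end IsTypeIIJonesPair

section BlockCirc

variable {R κ κ' μ : Type*} [CommRing R]

/-- The block circulant matrix which acts as `2 S` on symmetric vectors `(p, p)` and as `2 T` on
antisymmetric vectors `(p, -p)`. -/
def blockCirc (S T : Matrix κ' κ R) : Matrix (κ' ⊕ κ') (κ ⊕ κ) R :=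
  Matrix.fromBlocks (S + T) (S - T) (S - T) (S + T)

/-- The symmetric (`η = 1`) or antisymmetric (`η = -1`) vector with first half `p`. -/
def twist (η : ℤˣ) (p : κ → R) : κ ⊕ κ → R :=
  Sum.elim p (η • p)

/-- The vector with both halves symmetric (`η = 1`) or both antisymmetric (`η = -1`) which is
determined by the first halves of its halves. -/
def doubleTwist (η : ℤˣ) (v : κ ⊕ κ → R) : (κ ⊕ κ) ⊕ (κ ⊕ κ) → R :=
  Sum.elim (twist η (v ∘ Sum.inl)) (twist η (v ∘ Sum.inr))

theorem blockCirc_add (S T S' T' : Matrix κ' κ R) :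
    blockCirc S T + blockCirc S' T' = blockCirc (S + S') (T + T') := by
  simp only [blockCirc, Matrix.fromBlocks_add, add_add_add_comm, add_sub_add_comm]

theorem blockCirc_transpose (S T : Matrix κ' κ R) : (blockCirc S T)ᵀ = blockCirc Sᵀ Tᵀ := by
  simp only [blockCirc, Matrix.fromBlocks_transpose, Matrix.transpose_add, Matrix.transpose_sub]

theorem blockCirc_zero : blockCirc (0 : Matrix κ' κ R) 0 = 0 := by
  simp only [blockCirc, add_zero, sub_zero, Matrix.fromBlocks_zero]

theorem twist_mul_twist (η θ : ℤˣ) (p q : κ → R) :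
    twist η p * twist θ q = twist (η * θ) (p * q) := by
  simp only [twist, ← Sum.elim_mul_mul, smul_mul_smul_comm]

theorem twist_add (η : ℤˣ) (p q : κ → R) : twist η (p + q) = twist η p + twist η q := by
  rw [twist, smul_add, Sum.elim_add_add]
  rfl

theorem twist_smul (η : ℤˣ) (c : R) (p : κ → R) : twist η (c • p) = c • twist η p := by
  ext (k | k)
  · rfl
  · exact smul_comm η c (p k)

theorem doubleTwist_smul (η : ℤˣ) (c : R) (v : κ ⊕ κ → R) :
    doubleTwist η (c • v) = c • doubleTwist η v := by
  ext (k | k)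
  · exact congrFun (twist_smul η c (v ∘ Sum.inl)) k
  · exact congrFun (twist_smul η c (v ∘ Sum.inr)) k

theorem doubleTwist_injective (η : ℤˣ) :
    Function.Injective (doubleTwist η : (κ ⊕ κ → R) → (κ ⊕ κ) ⊕ (κ ⊕ κ) → R) := fun v w h ↦ by
  ext (k | k)
  · exact congrFun h (Sum.inl (Sum.inl k))
  · exact congrFun h (Sum.inr (Sum.inl k))

theorem blockCirc_smul_one [DecidableEq κ] (c : R) :
    blockCirc (c • 1 : Matrix κ κ R) (c • 1) = (2 * c) • 1 := by
  rw [blockCirc, sub_self, ← two_smul R, smul_smul, ← Matrix.fromBlocks_one,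
    Matrix.fromBlocks_smul, smul_zero]

section Mul

variable [Fintype κ]

theorem blockCirc_mul (S T : Matrix κ' κ R) (S' T' : Matrix κ μ R) :
    blockCirc S T * blockCirc S' T' = (2 : R) • blockCirc (S * S') (T * T') := by
  simp only [blockCirc, Matrix.fromBlocks_multiply, Matrix.fromBlocks_smul (2 : R), two_smul R,
    Matrix.add_mul, Matrix.mul_add, Matrix.sub_mul, Matrix.mul_sub]
  congr 1 <;> abel

theorem blockCirc_mulVec_twist_one (S T : Matrix κ' κ R) (p : κ → R) :
    blockCirc S T *ᵥ twist 1 p = (2 : R) • twist 1 (S *ᵥ p) := by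
  rw [← twist_smul]
  simp only [blockCirc, twist, Matrix.fromBlocks_mulVec, Sum.elim_comp_inl, Sum.elim_comp_inr,
    one_smul, ← Matrix.add_mulVec, add_add_sub_cancel, sub_add_add_cancel, ← two_smul R,
    Matrix.smul_mulVec]

theorem blockCirc_mulVec_twist_neg_one (S T : Matrix κ' κ R) (p : κ → R) :
    blockCirc S T *ᵥ twist (-1) p = (2 : R) • twist (-1) (T *ᵥ p) := by
  rw [← twist_smul]
  simp only [blockCirc, twist, Matrix.fromBlocks_mulVec, Sum.elim_comp_inl, Sum.elim_comp_inr,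
    Units.neg_smul, one_smul, Matrix.mulVec_neg, Matrix.add_mulVec, Matrix.sub_mulVec, two_smul R]
  congr 1 <;> abel

variable {F F₁ G G₁ P P₁ H H₁ : Matrix κ κ R}

theorem fromBlocks_blockCirc_mulVec_one (v : κ ⊕ κ → R) :
    Matrix.fromBlocks (blockCirc F P) (blockCirc G H) (blockCirc G₁ H₁) (blockCirc F₁ P₁) *ᵥ
      doubleTwist 1 v = (2 : R) • doubleTwist 1 (Matrix.fromBlocks F G G₁ F₁ *ᵥ v) := by
  rw [← doubleTwist_smul]
  simp only [doubleTwist, Matrix.fromBlocks_mulVec, Sum.elim_comp_inl, Sum.elim_comp_inr,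
    blockCirc_mulVec_twist_one, ← twist_smul, ← twist_add, ← smul_add]
  rfl

theorem fromBlocks_blockCirc_mulVec_neg_one (v : κ ⊕ κ → R) :
    Matrix.fromBlocks (blockCirc F P) (blockCirc G H) (blockCirc G₁ H₁) (blockCirc F₁ P₁) *ᵥ
      doubleTwist (-1) v = (2 : R) • doubleTwist (-1) (Matrix.fromBlocks P H H₁ P₁ *ᵥ v) := by
  rw [← doubleTwist_smul]
  simp only [doubleTwist, Matrix.fromBlocks_mulVec, Sum.elim_comp_inl, Sum.elim_comp_inr,
    blockCirc_mulVec_twist_neg_one, ← twist_smul, ← twist_add, ← smul_add]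
  rfl

end Mul

section Field

variable {𝕜 : Type*} [Field 𝕜] [NeZero (2 : 𝕜)] [Fintype κ] [DecidableEq κ]

theorem exists_eq_blockCirc_of_mul_comm {Y : Matrix (κ ⊕ κ) (κ ⊕ κ) 𝕜}
    (hY : blockCirc 1 (-1) * Y = Y * blockCirc 1 (-1)) : ∃ S T, Y = blockCirc S T := by
  have hswap : blockCirc (1 : Matrix κ κ 𝕜) (-1) = (2 : 𝕜) • Matrix.fromBlocks 0 1 1 0 := by
    simp only [blockCirc, add_neg_cancel, sub_neg_eq_add, Matrix.fromBlocks_smul (2 : 𝕜),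
      two_smul 𝕜, add_zero]
  rw [hswap, Matrix.smul_mul, Matrix.mul_smul, ← Y.fromBlocks_toBlocks] at hY
  have hY' := smul_right_injective _ (two_ne_zero (α := 𝕜)) hY
  simp only [Matrix.fromBlocks_multiply, zero_mul, one_mul, zero_add, add_zero, Matrix.mul_zero,
    Matrix.mul_one, Matrix.fromBlocks_inj] at hY'
  obtain ⟨h₂₁, h₂₂, -, -⟩ := hY'
  refine ⟨(2 : 𝕜)⁻¹ • (Y.toBlocks₁₁ + Y.toBlocks₁₂),
    (2 : 𝕜)⁻¹ • (Y.toBlocks₁₁ - Y.toBlocks₁₂), ?_⟩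
  conv_lhs => rw [← Y.fromBlocks_toBlocks, h₂₁, h₂₂]
  have half (a b : Matrix κ κ 𝕜) : (2 : 𝕜)⁻¹ • (a + b) + (2 : 𝕜)⁻¹ • (a - b) = a := by
    rw [← smul_add, add_add_sub_cancel, ← two_smul 𝕜, inv_smul_smul₀ two_ne_zero]
  have half' (a b : Matrix κ κ 𝕜) : (2 : 𝕜)⁻¹ • (a + b) - (2 : 𝕜)⁻¹ • (a - b) = b := by
    rw [← smul_sub, add_sub_sub_cancel, ← two_smul 𝕜, inv_smul_smul₀ two_ne_zero]
  rw [blockCirc, half, half']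

theorem exists_eq_fromBlocks_blockCirc_of_commute
    {Z : Matrix ((κ ⊕ κ) ⊕ (κ ⊕ κ)) ((κ ⊕ κ) ⊕ (κ ⊕ κ)) 𝕜}
    (hZ : Commute (Matrix.fromBlocks (blockCirc 1 (-1)) 0 0 (blockCirc 1 (-1))) Z) :
    ∃ F P G H G₁ H₁ F₁ P₁ : Matrix κ κ 𝕜, Z = Matrix.fromBlocks (blockCirc F P) (blockCirc G H)
      (blockCirc G₁ H₁) (blockCirc F₁ P₁) := by
  rw [commute_iff_eq, ← Z.fromBlocks_toBlocks] at hZ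
  simp only [Matrix.fromBlocks_multiply, zero_mul, zero_add, add_zero, Matrix.mul_zero,
    Matrix.fromBlocks_inj] at hZ
  obtain ⟨h₁₁, h₁₂, h₂₁, h₂₂⟩ := hZ
  obtain ⟨F, P, hF⟩ := exists_eq_blockCirc_of_mul_comm h₁₁
  obtain ⟨G, H, hG⟩ := exists_eq_blockCirc_of_mul_comm h₁₂
  obtain ⟨G₁, H₁, hG₁⟩ := exists_eq_blockCirc_of_mul_comm h₂₁
  obtain ⟨F₁, P₁, hF₁⟩ := exists_eq_blockCirc_of_mul_comm h₂₂
  exact ⟨F, P, G, H, G₁, H₁, F₁, P₁, by rw [← hF, ← hG, ← hG₁, ← hF₁, Z.fromBlocks_toBlocks]⟩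

end Field

end BlockCirc

section BlockTransfers

variable {𝕜 ι κ : Type*} [Field 𝕜] [Fintype κ] {F G G₁ F₁ : Matrix κ κ 𝕜}
  {u w : ι → ι → κ → 𝕜}

/-- The diagonal blocks `F`, `F₁` act on the families `u`, `w` with common eigenvalues, and the
off-diagonal blocks `G`, `G₁` exchange the two families with common coefficients. Equivalently, all
vectors `(± u i j, w i j)` are eigenvectors of the block matrix. -/
def BlockTransfers (F G G₁ F₁ : Matrix κ κ 𝕜) (u w : ι → ι → κ → 𝕜) : Prop :=
  (∃ S, Transfers F u u S ∧ Transfers F₁ w w S) ∧ ∃ T, Transfers G w u T ∧ Transfers G₁ u w T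

/-- A column index `i` of one half of `V` stands for the two columns indexed by `inl i` and `inr i`,
which agree up to the sign of some of their entries. -/
def halfSign (s : ι ⊕ ι) : ℤˣ :=
  Sum.elim 1 (-1) s

/-- The index in `ι` underlying a column index of one half of `V`. -/
def halfIndex (s : ι ⊕ ι) : ι :=
  Sum.elim id id s

theorem fromBlocks_mulVec_elim_units_smul_iff (p q : κ → 𝕜) (σ τ : ℤˣ) (c : 𝕜) :
    Matrix.fromBlocks F G G₁ F₁ *ᵥ Sum.elim (σ • p) (τ • q) = c • Sum.elim (σ • p) (τ • q) ↔
      F *ᵥ p + (σ * τ) • G *ᵥ q = c • p ∧ (σ * τ) • G₁ *ᵥ p + F₁ *ᵥ q = c • q := by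
  have hsmul (a b : κ → 𝕜) : c • Sum.elim a b = Sum.elim (c • a) (c • b) := by
    ext (k | k) <;> rfl
  have hσ : σ * (σ * τ) = τ := by rw [← mul_assoc, Int.units_mul_self, one_mul]
  have hτ : τ * (σ * τ) = σ := by rw [mul_comm, mul_assoc, Int.units_mul_self, mul_one]
  rw [Matrix.fromBlocks_mulVec, hsmul, Sum.elim_eq_iff]
  simp only [Sum.elim_comp_inl, Sum.elim_comp_inr, Matrix.mulVec_smul, smul_comm c]
  refine and_congr ?_ ?_
  · rw [← smul_left_cancel_iff σ (y := c • p), smul_add, smul_smul, hσ]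
  · rw [← smul_left_cancel_iff τ (y := c • q), smul_add, smul_smul, hτ]

theorem blockTransfers_iff [NeZero (2 : 𝕜)] {σ τ : ι ⊕ ι → ι ⊕ ι → ℤˣ}
    (hστ : ∀ s t, σ s t * τ s t = halfSign s * halfSign t) :
    BlockTransfers F G G₁ F₁ u w ↔ ∀ s t, ∃ c : 𝕜, Matrix.fromBlocks F G G₁ F₁ *ᵥ
      Sum.elim (σ s t • u (halfIndex s) (halfIndex t)) (τ s t • w (halfIndex s) (halfIndex t)) =
        c • Sum.elim (σ s t • u (halfIndex s) (halfIndex t))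
          (τ s t • w (halfIndex s) (halfIndex t)) := by
  simp only [fromBlocks_mulVec_elim_units_smul_iff, hστ]
  constructor
  · rintro ⟨⟨S, hF, hF₁⟩, T, hG, hG₁⟩ s t
    refine ⟨S (halfIndex s) (halfIndex t) +
      (halfSign s * halfSign t) • T (halfIndex s) (halfIndex t), ?_, ?_⟩
    · rw [hF, hG, add_smul, smul_assoc]
    · rw [hF₁, hG₁, add_smul, smul_assoc, add_comm]
  · intro h
    choose a ha ha₁ using fun i j ↦ h (Sum.inl i) (Sum.inl j)
    choose b hb hb₁ using fun i j ↦ h (Sum.inl i) (Sum.inr j)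
    simp only [halfSign, halfIndex, Sum.elim_inl, Sum.elim_inr, id, Pi.one_apply, Pi.neg_apply,
      one_mul, one_smul, Units.neg_smul] at ha ha₁ hb hb₁
    have hdiag {x y z : κ → 𝕜} {c e : 𝕜} (hc : x + y = c • z) (he : x + -y = e • z) :
        x = ((2 : 𝕜)⁻¹ * (c + e)) • z := by
      rw [mul_smul, add_smul, ← hc, ← he, add_add_add_comm, add_neg_cancel, add_zero, ← two_smul 𝕜,
        inv_smul_smul₀ two_ne_zero]
    have hoff {x y z : κ → 𝕜} {c e : 𝕜} (hc : x + y = c • z) (he : x + -y = e • z) :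
        y = ((2 : 𝕜)⁻¹ * (c - e)) • z := by
      rw [mul_smul, sub_smul, ← hc, ← he, ← sub_eq_add_neg, add_sub_sub_cancel, ← two_smul 𝕜,
        inv_smul_smul₀ two_ne_zero]
    exact ⟨⟨fun i j ↦ (2 : 𝕜)⁻¹ * (a i j + b i j), fun i j ↦ hdiag (ha i j) (hb i j), fun i j ↦
      hdiag ((add_comm _ _).trans (ha₁ i j)) ((add_comm _ _).trans (hb₁ i j))⟩,
      fun i j ↦ (2 : 𝕜)⁻¹ * (a i j - b i j), fun i j ↦ hoff (ha i j) (hb i j), fun i j ↦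
      hoff ((add_comm _ _).trans (ha₁ i j)) ((add_comm _ _).trans (hb₁ i j))⟩

theorem blockTransfers_smul_one [DecidableEq κ] (c : 𝕜) :
    BlockTransfers (c • 1) 0 0 (c • 1) u w := by
  have hscalar (v : ι → ι → κ → 𝕜) : Transfers (c • 1) v v fun _ _ ↦ c := fun i j ↦ by
    rw [Matrix.smul_mulVec, Matrix.one_mulVec]
  have hzero (v v' : ι → ι → κ → 𝕜) : Transfers 0 v v' 0 := fun i j ↦ by
    rw [Matrix.zero_mulVec, Matrix.zero_apply, zero_smul]
  exact ⟨⟨_, hscalar u, hscalar w⟩, _, hzero w u, hzero u w⟩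

end BlockTransfers

section V

variable {ι : Type*} {A B : Matrix ι ι ℂ} {d : ℂ}

theorem V_eq_fromBlocks (A B : Matrix ι ι ℂ) (d : ℂ) :
    V A B d = Matrix.fromBlocks (blockCirc 0 (d • A)) (blockCirc (schurInv B) 0)
      (blockCirc (schurInv B)ᵀ 0) (blockCirc 0 (d • A)) := by
  simp only [V, blocks4, blockCirc, zero_add, zero_sub, add_zero, sub_zero]

theorem schurInv_V (A B : Matrix ι ι ℂ) (d : ℂ) :
    schurInv (V A B d) = V (schurInv A) (schurInv B) d⁻¹ := by
  ext ((i | i) | (i | i)) ((j | j) | (j | j)) <;>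
    simp [V, blocks4, schurInv, mul_comm]

theorem V_col_inl (A B : Matrix ι ι ℂ) (d : ℂ) (s : ι ⊕ ι) :
    (V A B d).col (Sum.inl s) = Sum.elim (twist (-1) (halfSign s • d • A.col (halfIndex s)))
      (twist 1 ((schurInv B)ᵀ.col (halfIndex s))) := by
  rcases s with i | i <;> ext ((k | k) | (k | k)) <;>
    simp [V, blocks4, twist, halfSign, halfIndex]

theorem V_col_inr (A B : Matrix ι ι ℂ) (d : ℂ) (s : ι ⊕ ι) :
    (V A B d).col (Sum.inr s) = Sum.elim (twist 1 ((schurInv B).col (halfIndex s)))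
      (twist (-1) (halfSign s • d • A.col (halfIndex s))) := by
  rcases s with i | i <;> ext ((k | k) | (k | k)) <;>
    simp [V, blocks4, twist, halfSign, halfIndex]

theorem colQuot_V_inl_inl (A B : Matrix ι ι ℂ) (hd : d ≠ 0) (s t : ι ⊕ ι) :
    colQuot (V A B d) (Sum.inl s) (Sum.inl t) = doubleTwist 1
      (Sum.elim ((halfSign s * halfSign t) • colQuot A (halfIndex s) (halfIndex t))
        ((1 : ℤˣ) • colQuot (schurInv B)ᵀ (halfIndex s) (halfIndex t))) := by
  rw [colQuot, colProd, schurInv_V, V_col_inl, V_col_inl, ← Sum.elim_mul_mul, twist_mul_twist,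
    twist_mul_twist, smul_mul_smul_comm, smul_mul_smul_comm, mul_inv_cancel₀ hd, one_smul,
    Int.units_mul_self, mul_one, one_smul]
  rfl

theorem colQuot_V_inr_inr (A B : Matrix ι ι ℂ) (hd : d ≠ 0) (s t : ι ⊕ ι) :
    colQuot (V A B d) (Sum.inr s) (Sum.inr t) = doubleTwist 1
      (Sum.elim ((1 : ℤˣ) • colQuot (schurInv B) (halfIndex s) (halfIndex t))
        ((halfSign s * halfSign t) • colQuot A (halfIndex s) (halfIndex t))) := by
  rw [colQuot, colProd, schurInv_V, V_col_inr, V_col_inr, ← Sum.elim_mul_mul, twist_mul_twist,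
    twist_mul_twist, smul_mul_smul_comm, smul_mul_smul_comm, mul_inv_cancel₀ hd, one_smul,
    Int.units_mul_self, Int.units_mul_self, one_smul]
  rfl

theorem colQuot_V_inl_inr (A B : Matrix ι ι ℂ) (d : ℂ) (s t : ι ⊕ ι) :
    colQuot (V A B d) (Sum.inl s) (Sum.inr t) = doubleTwist (-1)
      (Sum.elim (halfSign s • (d • colProd A B) (halfIndex s) (halfIndex t))
        (halfSign t •
          (d⁻¹ • colProd (schurInv B)ᵀ (schurInv A)) (halfIndex s) (halfIndex t))) := by
  rw [colQuot, colProd, schurInv_V, V_col_inl, V_col_inr, ← Sum.elim_mul_mul, twist_mul_twist,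
    twist_mul_twist, schurInv_schurInv, mul_one, one_mul, smul_mul_assoc, smul_mul_assoc,
    mul_smul_comm, mul_smul_comm]
  rfl

theorem colQuot_V_inr_inl (A B : Matrix ι ι ℂ) (d : ℂ) (s t : ι ⊕ ι) :
    colQuot (V A B d) (Sum.inr s) (Sum.inl t) = doubleTwist (-1)
      (Sum.elim (halfSign t •
          (d⁻¹ • colProd (schurInv B) (schurInv A)) (halfIndex s) (halfIndex t))
        (halfSign s • (d • colProd A Bᵀ) (halfIndex s) (halfIndex t))) := by
  rw [colQuot, colProd, schurInv_V, V_col_inr, V_col_inl, ← Sum.elim_mul_mul, twist_mul_twist,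
    twist_mul_twist, schurInv_schurInv, mul_one, one_mul, smul_mul_assoc, smul_mul_assoc,
    mul_smul_comm, mul_smul_comm]
  rfl

theorem SchurInvertible.V (hA : SchurInvertible A) (hB : SchurInvertible B) (hd : d ≠ 0) :
    SchurInvertible (V A B d) := by
  have hdA := hA.smul hd
  have hB' := hB.schurInv
  rintro ((i | i) | (i | i)) ((j | j) | (j | j))
  all_goals first
    | exact hdA i j
    | exact neg_ne_zero.mpr (hdA i j)
    | exact hB' i j
    | exact hB' j i

theorem exists_two_smul_doubleTwist_eq_iff (η : ℤˣ) (v w : ι ⊕ ι → ℂ) :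
    (∃ c : ℂ, (2 : ℂ) • doubleTwist η v = c • doubleTwist η w) ↔ ∃ c : ℂ, v = c • w := by
  simp only [← doubleTwist_smul, (doubleTwist_injective η).eq_iff]
  constructor
  · rintro ⟨c, hc⟩
    exact ⟨(2 : ℂ)⁻¹ * c, by rw [mul_smul, ← hc, inv_smul_smul₀ two_ne_zero]⟩
  · rintro ⟨c, rfl⟩
    exact ⟨2 * c, smul_smul _ _ _⟩

variable [Fintype ι] [DecidableEq ι]

theorem IsTypeII.V (hA : IsTypeII A) (hB : IsTypeII B) (hd : d ≠ 0) : IsTypeII (V A B d) where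
  schurInvertible := hA.schurInvertible.V hB.schurInvertible hd
  mul_schurInv_transpose := by
    have hcard : (Fintype.card ((ι ⊕ ι) ⊕ (ι ⊕ ι)) : ℂ) = 2 * (2 * Fintype.card ι) := by
      simp only [Fintype.card_sum, Nat.cast_add, two_mul]
    have hB' : JonesPair.schurInv B * Bᵀ = (Fintype.card ι : ℂ) • 1 := by
      simpa only [schurInv_schurInv] using hB.schurInv.mul_schurInv_transpose
    rw [schurInv_V, V_eq_fromBlocks, V_eq_fromBlocks, Matrix.fromBlocks_transpose,
      Matrix.fromBlocks_multiply]
    simp only [blockCirc_transpose, schurInv_schurInv, Matrix.transpose_zero, blockCirc_mul,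
      Matrix.transpose_transpose, ← smul_add, blockCirc_add, Matrix.mul_zero, Matrix.zero_mul,
      zero_add, add_zero, blockCirc_zero, smul_zero, Matrix.transpose_smul, Matrix.smul_mul,
      Matrix.mul_smul, smul_smul, hA.mul_schurInv_transpose, hB.schurInv_transpose_mul, hB',
      inv_mul_cancel_left₀ hd, blockCirc_smul_one]
    rw [hcard, ← Matrix.fromBlocks_one (l := ι ⊕ ι) (m := ι ⊕ ι),
      Matrix.fromBlocks_smul, smul_zero]

variable {F F₁ G G₁ R R₁ H H₁ : Matrix ι ι ℂ}

theorem mem_nomura_V_iff (hd : d ≠ 0) :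
    Matrix.fromBlocks (blockCirc F R) (blockCirc G H) (blockCirc G₁ H₁) (blockCirc F₁ R₁) ∈
        nomura (V A B d) ↔
      BlockTransfers F G G₁ F₁ (colQuot A) (colQuot (schurInv B)ᵀ) ∧
      BlockTransfers F G G₁ F₁ (colQuot (schurInv B)) (colQuot A) ∧
      BlockTransfers R H H₁ R₁ (d • colProd A B) (d⁻¹ • colProd (schurInv B)ᵀ (schurInv A)) ∧
      BlockTransfers R H H₁ R₁ (d⁻¹ • colProd (schurInv B) (schurInv A)) (d • colProd A Bᵀ) := by
  rw [blockTransfers_iff (σ := fun s t ↦ halfSign s * halfSign t) (τ := 1) fun _ _ ↦ mul_one _,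
    blockTransfers_iff (σ := 1) (τ := fun s t ↦ halfSign s * halfSign t) fun _ _ ↦ one_mul _,
    blockTransfers_iff (σ := fun s _ ↦ halfSign s) (τ := fun _ t ↦ halfSign t) fun _ _ ↦ rfl,
    blockTransfers_iff (σ := fun _ t ↦ halfSign t) (τ := fun s _ ↦ halfSign s)
      fun _ _ ↦ mul_comm _ _]
  change (∀ i j, ∃ c : ℂ, _ *ᵥ colQuot (V A B d) i j = c • colQuot (V A B d) i j) ↔ _
  simp only [Sum.forall (α := ι ⊕ ι) (β := ι ⊕ ι), colQuot_V_inl_inl A B hd,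
    colQuot_V_inr_inr A B hd, colQuot_V_inl_inr, colQuot_V_inr_inl, fromBlocks_blockCirc_mulVec_one,
    fromBlocks_blockCirc_mulVec_neg_one, exists_two_smul_doubleTwist_eq_iff, forall_and,
    Pi.one_apply]
  exact ⟨fun ⟨⟨h₁₁, h₂₁⟩, h₁₂, h₂₂⟩ ↦ ⟨h₁₁, h₂₂, h₁₂, h₂₁⟩,
    fun ⟨h₁₁, h₂₂, h₁₂, h₂₁⟩ ↦ ⟨⟨h₁₁, h₂₁⟩, h₁₂, h₂₂⟩⟩

theorem fromBlocks_blockCirc_one_neg_one_mem_nomura_V (hd : d ≠ 0) :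
    Matrix.fromBlocks (blockCirc 1 (-1)) 0 0 (blockCirc 1 (-1)) ∈ nomura (V A B d) := by
  rw [← blockCirc_zero, mem_nomura_V_iff hd]
  have hsymm {u w : ι → ι → ι → ℂ} : BlockTransfers 1 0 0 1 u w := by
    simpa only [one_smul] using blockTransfers_smul_one (u := u) (w := w) (1 : ℂ)
  have hantisymm {u w : ι → ι → ι → ℂ} : BlockTransfers (-1) 0 0 (-1) u w := by
    simpa only [neg_smul, one_smul] using blockTransfers_smul_one (u := u) (w := w) (-1 : ℂ)
  exact ⟨hsymm, hsymm, hantisymm, hantisymm⟩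

theorem exists_eq_fromBlocks_blockCirc_of_mem_nomura_V [Nonempty ι] (hA : IsTypeII A)
    (hB : IsTypeII B) (hd : d ≠ 0) {Z : Matrix ((ι ⊕ ι) ⊕ (ι ⊕ ι)) ((ι ⊕ ι) ⊕ (ι ⊕ ι)) ℂ}
    (hZ : Z ∈ nomura (V A B d)) :
    ∃ F R G H G₁ H₁ F₁ R₁ : Matrix ι ι ℂ, Z = Matrix.fromBlocks (blockCirc F R) (blockCirc G H)
      (blockCirc G₁ H₁) (blockCirc F₁ R₁) :=
  have hV := hA.V hB hd
  exists_eq_fromBlocks_blockCirc_of_commute <| commute_of_mem_nomuraPair hV.isUnit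
    hV.schurInvertible.schurInv (fromBlocks_blockCirc_one_neg_one_mem_nomura_V hd) hZ

end V

section MainTheorem

variable {ι : Type*} [Fintype ι] [DecidableEq ι] [Nonempty ι]
  {A B F F₁ G G₁ R R₁ H H₁ : Matrix ι ι ℂ}

namespace IsTypeIIJonesPair

theorem mem_dualNomuraPair_iff_exists_transfers (h : IsTypeIIJonesPair A B) :
    G ∈ dualNomuraPair A B ↔ ∃ T, Transfers G (colQuot (schurInv B)ᵀ) (colQuot A) T := by
  have hcard : (Fintype.card ι : ℂ) ≠ 0 := Nat.cast_ne_zero.mpr Fintype.card_ne_zero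
  simp only [mem_dualNomuraPair_iff h.left.schurInvertible h.right.schurInvertible,
    h.transfers_colProd_iff]
  refine ⟨fun ⟨M, hM⟩ ↦ ⟨_, hM⟩, fun ⟨T, hT⟩ ↦ ⟨((Fintype.card ι : ℂ)⁻¹ • T)ᵀ, ?_⟩⟩
  rwa [Matrix.transpose_transpose, smul_inv_smul₀ hcard]

theorem blockTransfers_colQuot_iff (h : IsTypeIIJonesPair A B) :
    BlockTransfers F G G₁ F₁ (colQuot A) (colQuot (schurInv B)ᵀ) ∧
        BlockTransfers F G G₁ F₁ (colQuot (schurInv B)) (colQuot A) ↔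
      F ∈ nomura A ∧ G ∈ dualNomuraPair A B ∧ G₁ = B⁻¹ * G * Bᵀ ∧ F₁ = B⁻¹ * F * B := by
  rw [mem_nomura_iff, h.mem_dualNomuraPair_iff_exists_transfers]
  constructor
  · rintro ⟨⟨⟨S, hF, hF₁⟩, T, hG, hG₁⟩, -⟩
    have hB := h.right.schurInv.transpose
    exact ⟨⟨S, hF⟩, ⟨T, hG⟩,
      hG₁.unique (h.transfers_inv_mul_mul_transpose hG) h.left.isUnit
        h.left.schurInvertible.schurInv,
      hF₁.unique (h.transfers_conj_right hF) hB.isUnit hB.schurInvertible.schurInv⟩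
  · rintro ⟨⟨S, hF⟩, ⟨T, hG⟩, rfl, rfl⟩
    obtain ⟨T', hG'⟩ := h.exists_transfers_schurInv_right hG
    have hB := h.transpose.transfers_right_transpose
    exact ⟨⟨⟨S, hF, h.transfers_conj_right hF⟩, T, hG, h.transfers_inv_mul_mul_transpose hG⟩,
      ⟨_, h.transfers_schurInv_right hF, (h.transfers_schurInv_right hF).conj hB hB
        h.right.isUnit h.schurInvertible_card_smul⟩,
      T', hG', h.transfers_inv_mul_mul_transpose_schurInv hG'⟩

theorem blockTransfers_colProd_iff (h : IsTypeIIJonesPair A B) {d : ℂ} (hd : d ≠ 0)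
    (hd' : d ^ 2 = Fintype.card ι) :
    BlockTransfers R H H₁ R₁ (d • colProd A B) (d⁻¹ • colProd (schurInv B)ᵀ (schurInv A)) ∧
        BlockTransfers R H H₁ R₁ (d⁻¹ • colProd (schurInv B) (schurInv A)) (d • colProd A Bᵀ) ↔
      R ∈ nomuraPair A B ∧ ThetaCompatible A B R R₁ ∧ OperatorCompatible A B H H₁ := by
  simp only [BlockTransfers, transfers_smul_smul_iff hd,
    transfers_smul_smul_iff (inv_ne_zero hd)]
  rw [← and_assoc (c := OperatorCompatible A B H H₁), h.nomuraPair_and_thetaCompatible_iff,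
    h.operatorCompatible_iff_transfers hd hd', and_and_and_comm]

theorem mem_nomura_V_iff_exists (h : IsTypeIIJonesPair A B) {d : ℂ} (hd : d ≠ 0)
    (hd' : d ^ 2 = Fintype.card ι) {Z : Matrix ((ι ⊕ ι) ⊕ (ι ⊕ ι)) ((ι ⊕ ι) ⊕ (ι ⊕ ι)) ℂ} :
    Z ∈ nomura (V A B d) ↔ ∃ F R G H R₁ H₁ : Matrix ι ι ℂ,
      F ∈ nomura A ∧ R ∈ nomuraPair A B ∧ G ∈ dualNomuraPair A B ∧ ThetaCompatible A B R R₁ ∧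
      OperatorCompatible A B H H₁ ∧ Z = Matrix.fromBlocks (blockCirc F R) (blockCirc G H)
        (blockCirc (B⁻¹ * G * Bᵀ) H₁) (blockCirc (B⁻¹ * F * B) R₁) := by
  constructor
  · intro hZ
    obtain ⟨F, R, G, H, G₁, H₁, F₁, R₁, rfl⟩ :=
      exists_eq_fromBlocks_blockCirc_of_mem_nomura_V h.left h.right hd hZ
    obtain ⟨hx, hy, hu, hw⟩ := (mem_nomura_V_iff hd).mp hZ
    obtain ⟨hF, hG, rfl, rfl⟩ := h.blockTransfers_colQuot_iff.mp ⟨hx, hy⟩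
    obtain ⟨hR, hθ, hH⟩ := (h.blockTransfers_colProd_iff hd hd').mp ⟨hu, hw⟩
    exact ⟨F, R, G, H, R₁, H₁, hF, hR, hG, hθ, hH, rfl⟩
  · rintro ⟨F, R, G, H, R₁, H₁, hF, hR, hG, hθ, hH, rfl⟩
    obtain ⟨hx, hy⟩ := h.blockTransfers_colQuot_iff.mpr ⟨hF, hG, rfl, rfl⟩
    obtain ⟨hu, hw⟩ := (h.blockTransfers_colProd_iff hd hd').mpr ⟨hR, hθ, hH⟩
    exact (mem_nomura_V_iff hd).mpr ⟨hx, hy, hu, hw⟩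

end IsTypeIIJonesPair

end MainTheorem

end JonesPair

open JonesPair in
theorem mainTheorem3_general {ι : Type*} [Fintype ι] [DecidableEq ι] (A B : Matrix ι ι ℂ) (d : ℂ)
    (hd : d ^ 2 = (Fintype.card ι : ℂ)) (hAB : IsJonesPair A B) (hB : IsUnit B) (hA : A.IsSymm) :
    (nomura (V A B d) : Set (Matrix _ _ ℂ)) =
      {Z | ∃ F R G H R₁ H₁ : Matrix ι ι ℂ,
        F ∈ nomura A ∧ R ∈ nomuraPair A B ∧ G ∈ dualNomuraPair A B ∧
        ThetaCompatible A B R R₁ ∧ OperatorCompatible A B H H₁ ∧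
        Z = blocks4
          (F + R)              (F - R)              (G + H)              (G - H)
          (F - R)              (F + R)              (G - H)              (G + H)
          (B⁻¹ * G * Bᵀ + H₁)  (B⁻¹ * G * Bᵀ - H₁)  (B⁻¹ * F * B + R₁)   (B⁻¹ * F * B - R₁)
          (B⁻¹ * G * Bᵀ - H₁)  (B⁻¹ * G * Bᵀ + H₁)  (B⁻¹ * F * B - R₁)   (B⁻¹ * F * B + R₁)} := by
  ext Z
  rcases isEmpty_or_nonempty ι with hι | hι
  · refine iff_of_true (Subsingleton.elim 0 Z ▸ zero_mem _) ⟨0, 0, 0, 0, 0, 0, zero_mem _,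
      zero_mem _, ⟨0, Subsingleton.elim _ _⟩, ?_, ?_, Subsingleton.elim _ _⟩
    · exact ⟨A.hadamard_zero.symm ▸ zero_mem _, A.hadamard_zero.symm ▸ zero_mem _,
        Subsingleton.elim _ _⟩
    · exact ⟨0, 0, by simp only [eq_iff_true_of_subsingleton, and_true]⟩
  · have hd₀ : d ≠ 0 := by
      rintro rfl
      exact Fintype.card_ne_zero (Nat.cast_eq_zero.mp ((zero_pow two_ne_zero).symm.trans hd).symm)
    exact (hAB.isTypeIIJonesPair hB hA).mem_nomura_V_iff_exists hd₀ hd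

theorem mainTheorem3 (n : ℕ) (A B : Matrix (Fin n) (Fin n) ℂ) (d : ℂ)
    (hd : d ^ 2 = (n : ℂ))
    (hAB : JonesPair.IsInvertibleJonesPair A B) (hA : A.IsSymm) :
    (JonesPair.nomura (JonesPair.V A B d) : Set (Matrix _ _ ℂ)) =
      {Z | ∃ F R G H R₁ H₁ : Matrix (Fin n) (Fin n) ℂ,
        F ∈ JonesPair.nomura A ∧
        R ∈ JonesPair.nomuraPair A B ∧
        G ∈ JonesPair.dualNomuraPair A B ∧
        (∃ (hR₁ : A ⊙ R₁ ∈ JonesPair.nomura Bᵀ) (hR : A ⊙ R ∈ JonesPair.nomura A),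
          (JonesPair.theta Bᵀ ⟨A ⊙ R₁, hR₁⟩)ᵀ = JonesPair.theta A ⟨A ⊙ R, hR⟩) ∧
        (∃ S S₁ : Matrix (Fin n) (Fin n) ℂ,
          JonesPair.X A⁻¹ * JonesPair.Δ (JonesPair.schurInv B) * JonesPair.X H *
              JonesPair.Δ (JonesPair.schurInv A) * JonesPair.X B⁻¹ = JonesPair.Δ S ∧
          JonesPair.Δ S =
            JonesPair.X B * JonesPair.Δ A * JonesPair.X H₁ * JonesPair.Δ B * JonesPair.X A ∧
          JonesPair.X Bᵀ * JonesPair.Δ A * JonesPair.X H *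
              JonesPair.Δ Bᵀ * JonesPair.X A = JonesPair.Δ S₁ ∧
          JonesPair.Δ S₁ =
            JonesPair.X A⁻¹ * JonesPair.Δ (JonesPair.schurInv B)ᵀ * JonesPair.X H₁ *
              JonesPair.Δ (JonesPair.schurInv A) * JonesPair.X (B⁻¹)ᵀ) ∧
        Z = JonesPair.blocks4
          (F + R)              (F - R)              (G + H)              (G - H)
          (F - R)              (F + R)              (G - H)              (G + H)
          (B⁻¹ * G * Bᵀ + H₁)  (B⁻¹ * G * Bᵀ - H₁)  (B⁻¹ * F * B + R₁)   (B⁻¹ * F * B - R₁)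
          (B⁻¹ * G * Bᵀ - H₁)  (B⁻¹ * G * Bᵀ + H₁)  (B⁻¹ * F * B - R₁)   (B⁻¹ * F * B + R₁)} :=
  mainTheorem3_general A B d (by rwa [Fintype.card_fin]) hAB.isJonesPair hAB.isUnit hA
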